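/- Let $R$ be a commutative artinian ring and let $\Lambda$ be an artin $R$-algebra, i.e. an $R$-algebra which is finitely generated as an $R$-module. All modules are finitely generated left $\Lambda$-modules unless stated otherwise. A morphism $\alpha\colon X\to Y$ is said to be \emph{right determined} by a module $C$ if every morphism $\alpha'\colon X'\to Y$ with the property that $\alpha'\phi$ factors through $\alpha$ for all $\phi\colon C\to X'$ factors itself through $\alpha$. Let $D=\operatorname{Hom}_R(-,E)$ be the duality from left to right $\Lambda$-modules, where $E$ is the injective envelope of the $R$-module $R/\operatorname{rad}R$. For a finitely generated right $\Lambda$-module $M$ with minimal projective presentation $P_1\to P_0\to M\to 0$, let $\operatorname{Tr}M$ be the left $\Lambda$-module $\operatorname{Cok}(\operatorname{Hom}_\Lambda(P_0,\Lambda)\to\operatorname{Hom}_\Lambda(P_1,\Lambda))$. Write $P(M)$ for the projective cover and $\operatorname{soc}M$ for the socle of a module $M$. Theorem. Let $\alpha\colon X\to Y$ be a morphism of finitely generated left $\Lambda$-modules with kernel $K$ and cokernel $Q$. Then $C=\operatorname{Tr}D(K)\oplus P(\operatorname{soc}Q)$ is a finitely generated left $\Lambda$-module, and $\alpha$ is right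 determined by $C$. -/

import Mathlib

universe u v w w₁ w₂ w₃ w₄

namespace ArtinAlg

/-! ### Projective covers -/

section ProjectiveCover

variable (A : Type u) [Ring A] (M : Type w) [AddCommGroup M] [Module A M]

/-- `π : P → M` is a projective cover: `P` is projective and `π` is surjective with
superfluous kernel. -/
def IsProjectiveCover {A : Type u} [Ring A] {P : Type v} [AddCommGroup P] [Module A P]
    {M : Type w} [AddCommGroup M] [Module A M] (π : P →ₗ[A] M) : Prop :=
  Module.Projective A P ∧ Function.Surjective π ∧
    ∀ N : Submodule A P, N ⊔ LinearMap.ker π = ⊤ → N = ⊤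

/-- A linear map to `M` from a submodule of some finite free module. -/
structure SubfreeMap where
  rank : ℕ
  source : Submodule A (Fin rank → A)
  map : source →ₗ[A] M

instance : Nonempty (SubfreeMap A M) := ⟨⟨0, ⊥, 0⟩⟩

/-- Finitely generated modules over an artinian ring have projective covers. -/
theorem exists_projectiveCover [IsArtinianRing A] [Module.Finite A M] :
    ∃ d : SubfreeMap A M, IsProjectiveCover d.map := by
  obtain ⟨n, f, hf⟩ := Module.Finite.exists_fin' A M
  let S : Set (Submodule A (Fin n → A)) := {P | Module.Projective A P ∧ P.map f = ⊤}
  have hS : S.Nonempty := by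
    refine ⟨⊤, Module.Projective.of_equiv (Submodule.topEquiv (R := A)
      (M := Fin n → A)).symm, ?_⟩
    rw [Submodule.map_top, LinearMap.range_eq_top.2 hf]
  obtain ⟨P, ⟨hP, hPf⟩, hmin⟩ := WellFounded.has_min
    (IsWellFounded.wf (α := Submodule A (Fin n → A)) (r := (· < ·))) S hS
  have hsurj : Function.Surjective (f.domRestrict P) := by
    rw [← LinearMap.range_eq_top, LinearMap.range_domRestrict, hPf]
  let π : P →ₗ[A] M := f.domRestrict P
  refine ⟨⟨n, P, π⟩, hP, hsurj, fun (N : Submodule A P) (hN : N ⊔ LinearMap.ker π = ⊤) => ?_⟩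
  have hNs : Function.Surjective (π ∘ₗ N.subtype) := by
    intro m
    obtain ⟨p, rfl⟩ := hsurj m
    obtain ⟨a, ha, b, hb, rfl⟩ := Submodule.mem_sup.1 (hN ▸ Submodule.mem_top : p ∈ N ⊔ _)
    refine ⟨⟨a, ha⟩, ?_⟩
    have hb' : π b = 0 := hb
    change π a = π (a + b)
    rw [map_add, hb', add_zero]
  obtain ⟨g, hg⟩ := Module.projective_lifting_property (π ∘ₗ N.subtype) π hNs
  let e : Module.End A P := N.subtype ∘ₗ g
  have he : ∀ x, π (e x) = π x := fun x => LinearMap.congr_fun hg x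
  obtain ⟨k, hk0, hk⟩ := ((Filter.eventually_gt_atTop 0).and
    (LinearMap.eventually_isCompl_ker_pow_range_pow e)).exists
  have hek : ∀ (j : ℕ) x, π ((e ^ j) x) = π x := by
    intro j
    induction j with
    | zero => intro x; rfl
    | succ j ih => intro x; rw [pow_succ', Module.End.mul_apply, he, ih]
  have hrN : LinearMap.range (e ^ k) ≤ N := by
    rintro _ ⟨x, rfl⟩
    obtain ⟨j, rfl⟩ := Nat.exists_eq_succ_of_ne_zero hk0.ne'
    rw [pow_succ', Module.End.mul_apply]
    exact (g _).2
  have hproj : Module.Projective A (LinearMap.range (e ^ k)) :=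
    Module.Projective.of_split (LinearMap.range (e ^ k)).subtype
      (Submodule.projectionOnto _ _ hk.symm)
      (LinearMap.ext fun x => Submodule.projectionOnto_apply_left hk.symm x)
  let Q := (LinearMap.range (e ^ k)).map P.subtype
  have hQP : Q ≤ P := Submodule.map_subtype_le _ _
  have hQS : Q ∈ S := by
    refine ⟨Module.Projective.of_equiv
      (Submodule.equivMapOfInjective P.subtype P.injective_subtype _), ?_⟩
    rw [eq_top_iff]
    rintro m -
    obtain ⟨p, rfl⟩ := hsurj m
    exact ⟨_, ⟨_, ⟨p, rfl⟩, rfl⟩, hek k p⟩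
  have hQ : Q = P := by
    by_contra h
    exact hmin Q hQS (lt_of_le_of_ne hQP h)
  rw [eq_top_iff]
  rintro p -
  have : (p : Fin n → A) ∈ Q := hQ.ge p.2
  obtain ⟨q, hq, hqp⟩ := this
  have hqp' : q = p := Subtype.ext hqp
  exact hqp' ▸ hrN hq

/-- A chosen projective cover of `M`; it exists for finitely generated modules over artinian
rings, and only such modules are considered below. -/
noncomputable def projCoverData : SubfreeMap A M :=
  Classical.epsilon fun d => IsProjectiveCover d.map

/-- The projective cover `P(M)`. -/
def ProjCover : Type u := (projCoverData A M).source

noncomputable instance : AddCommGroup (ProjCover A M) :=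
  inferInstanceAs (AddCommGroup (projCoverData A M).source)

noncomputable instance : Module A (ProjCover A M) :=
  inferInstanceAs (Module A (projCoverData A M).source)

instance [IsNoetherianRing A] : IsNoetherian A (ProjCover A M) :=
  inferInstanceAs (IsNoetherian A (projCoverData A M).source)

/-- The covering map `P(M) → M`. -/
noncomputable def projCoverMap : ProjCover A M →ₗ[A] M := (projCoverData A M).map

theorem projCoverMap_isProjectiveCover [IsArtinianRing A] [Module.Finite A M] :
    IsProjectiveCover (projCoverMap A M) :=
  Classical.epsilon_spec (exists_projectiveCover A M)

/-- The socle: the sum of all simple submodules. -/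
def socle : Submodule A M := sSup {S | IsSimpleModule A S}

end ProjectiveCover

/-! ### Injective envelopes and the duality -/

section Dual

/-- `ι : M → E` is an injective envelope: `E` is injective and `ι` is an essential
monomorphism. -/
def IsInjectiveEnvelope {R : Type u} [Ring R] {M : Type v} [AddCommGroup M] [Module R M]
    {E : Type w} [AddCommGroup E] [Module R E] (ι : M →ₗ[R] E) : Prop :=
  Module.Injective R E ∧ Function.Injective ι ∧
    ∀ N : Submodule R E, N ⊓ LinearMap.range ι = ⊥ → N = ⊥

/-- Every module has an injective envelope. -/
theorem exists_injectiveEnvelope (R : Type u) [Ring R] (M : Type u) [AddCommGroup M]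
    [Module R M] : ∃ (E : Type u) (_ : AddCommGroup E) (_ : Module R E) (ι : M →ₗ[R] E),
      IsInjectiveEnvelope ι := by
  obtain ⟨pres⟩ := CategoryTheory.EnoughInjectives.presentation (ModuleCat.of R M)
  obtain ⟨J, iJ, f, mf⟩ := pres
  have hJ : Module.Injective R J := (Module.injective_iff_injective_object R J).2 iJ
  let j : M →ₗ[R] J := f.hom
  have hj : Function.Injective j := (ModuleCat.mono_iff_injective f).1 mf
  let S : Set (Submodule R J) :=
    {N | LinearMap.range j ≤ N ∧ ∀ L ≤ N, L ⊓ LinearMap.range j = ⊥ → L = ⊥}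
  have hjS : LinearMap.range j ∈ S := ⟨le_rfl, fun L hL h => by rwa [inf_eq_left.2 hL] at h⟩
  obtain ⟨E, -, hE⟩ := zorn_le_nonempty₀ S (by
    intro c hcS hc y hy
    refine ⟨sSup c, ⟨(hcS hy).1.trans (le_sSup hy), ?_⟩, fun z hz => le_sSup hz⟩
    intro L hL h
    rw [eq_bot_iff]
    intro x hx
    obtain ⟨N, hN, hxN⟩ := (Submodule.mem_sSup_of_directed ⟨y, hy⟩ hc.directedOn).1 (hL hx)
    have : L ⊓ N = ⊥ := (hcS hN).2 _ inf_le_right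
      (eq_bot_iff.2 (h ▸ inf_le_inf_right _ inf_le_left))
    rw [← this]
    exact ⟨hx, hxN⟩) _ hjS
  obtain ⟨L₀, -, hL₀⟩ := zorn_le_nonempty₀ {L : Submodule R J | L ⊓ E = ⊥} (by
    intro c hcS hc y hy
    refine ⟨sSup c, ?_, fun z hz => le_sSup hz⟩
    change sSup c ⊓ E = ⊥
    rw [eq_bot_iff]
    rintro x ⟨hx, hxE⟩
    obtain ⟨N, hN, hxN⟩ := (Submodule.mem_sSup_of_directed ⟨y, hy⟩ hc.directedOn).1 hx
    have : N ⊓ E = ⊥ := hcS hN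
    rw [← this]
    exact ⟨hxN, hxE⟩) ⊥ (bot_inf_eq _)
  have hL₀E : L₀ ⊓ E = ⊥ := hL₀.prop
  have hmax : ∀ L, L₀ ≤ L → L ⊓ E = ⊥ → L ≤ L₀ := fun L h h' => hL₀.le_of_ge h' h
  have hq : Function.Injective (L₀.mkQ ∘ₗ E.subtype) := by
    rw [← LinearMap.ker_eq_bot, eq_bot_iff]
    intro x hx
    have h1 : (x : J) ∈ L₀ := by simpa using hx
    have h2 : (x : J) ∈ L₀ ⊓ E := ⟨h1, x.2⟩
    rw [hL₀E] at h2
    exact Subtype.ext h2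
  obtain ⟨g, hg⟩ := hJ.out (L₀.mkQ ∘ₗ E.subtype) hq E.subtype
  have hgE : ∀ x ∈ E, g (L₀.mkQ x) = x := fun x hx => hg ⟨x, hx⟩
  have hgS : LinearMap.range g ∈ S := by
    refine ⟨fun x hx => ⟨_, hgE x (hE.prop.1 hx)⟩, fun L hL h => ?_⟩
    have hLE : L ⊓ E = ⊥ := hE.prop.2 _ inf_le_right
      (eq_bot_iff.2 (h ▸ inf_le_inf_right _ inf_le_left))
    have h1 : L.comap (g ∘ₗ L₀.mkQ) ≤ L₀ := by
      apply hmax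
      · intro x hx
        have : L₀.mkQ x = 0 := by simpa using hx
        rw [Submodule.mem_comap, LinearMap.comp_apply, this, map_zero]
        exact L.zero_mem
      · rw [eq_bot_iff]
        rintro x ⟨hx, hxE⟩
        rw [← hLE]
        have hx' : g (L₀.mkQ x) ∈ L := hx
        rw [hgE x hxE] at hx'
        exact ⟨hx', hxE⟩
    rw [eq_bot_iff]
    intro x hx
    obtain ⟨y, rfl⟩ := hL hx
    obtain ⟨z, rfl⟩ := L₀.mkQ_surjective y
    have : z ∈ L₀ := h1 hx
    have : L₀.mkQ z = 0 := by simpa using this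
    rw [this, map_zero]
    exact Submodule.zero_mem _
  have hgle : LinearMap.range g ≤ E :=
    hE.le_of_ge hgS (fun x hx => ⟨_, hgE x hx⟩)
  let r : J →ₗ[R] E := (g ∘ₗ L₀.mkQ).codRestrict E fun x => hgle ⟨_, rfl⟩
  refine ⟨E, inferInstance, inferInstance, j.codRestrict E fun x => hE.prop.1 ⟨x, rfl⟩,
    ⟨?_⟩, ?_, ?_⟩
  · intro X Y _ _ _ _ a ha b
    obtain ⟨h, hh⟩ := hJ.out a ha (E.subtype ∘ₗ b)
    refine ⟨r ∘ₗ h, fun x => Subtype.ext ?_⟩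
    change g (L₀.mkQ (h (a x))) = _
    rw [hh]
    exact hgE _ (b x).2
  · intro x y h
    exact hj (congrArg Subtype.val h)
  · intro N hN
    have h1 : N.map E.subtype = ⊥ := by
      refine hE.prop.2 _ (Submodule.map_subtype_le _ _) ?_
      rw [eq_bot_iff]
      rintro _ ⟨⟨x, hx, rfl⟩, ⟨m, hm⟩⟩
      have : x ∈ N ⊓ LinearMap.range (j.codRestrict E fun x => hE.prop.1 ⟨x, rfl⟩) :=
        ⟨hx, m, Subtype.ext hm⟩
      rw [hN] at this
      have : x = 0 := this
      rw [this]
      exact Submodule.zero_mem _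
    exact Submodule.map_injective_of_injective E.injective_subtype
      (h1.trans (Submodule.map_bot _).symm)

variable (R : Type u) [CommRing R]

/-- The injective envelope `E` of the `R`-module `R / rad R`. -/
def InjCogenerator : Type u :=
  (exists_injectiveEnvelope R (R ⧸ Ring.jacobson R)).choose

noncomputable instance : AddCommGroup (InjCogenerator R) :=
  (exists_injectiveEnvelope R (R ⧸ Ring.jacobson R)).choose_spec.choose

noncomputable instance : Module R (InjCogenerator R) :=
  (exists_injectiveEnvelope R (R ⧸ Ring.jacobson R)).choose_spec.choose_spec.choose

/-- The embedding of `R / rad R` into its injective envelope. -/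
noncomputable def injCogeneratorMap : (R ⧸ Ring.jacobson R) →ₗ[R] InjCogenerator R :=
  (exists_injectiveEnvelope R (R ⧸ Ring.jacobson R)).choose_spec.choose_spec.choose_spec.choose

theorem injCogeneratorMap_isInjectiveEnvelope : IsInjectiveEnvelope (injCogeneratorMap R) :=
  (exists_injectiveEnvelope R
    (R ⧸ Ring.jacobson R)).choose_spec.choose_spec.choose_spec.choose_spec

variable (K : Type w) [AddCommGroup K] [Module R K]

/-- The dual `D(K) = Hom_R(K, E)`. -/
def Dual : Type (max w u) := K →ₗ[R] InjCogenerator R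

noncomputable instance : AddCommGroup (Dual R K) :=
  inferInstanceAs (AddCommGroup (K →ₗ[R] InjCogenerator R))

noncomputable instance : Module R (Dual R K) :=
  inferInstanceAs (Module R (K →ₗ[R] InjCogenerator R))

variable {R K} in
/-- Evaluation of an element of `D(K)`. -/
def Dual.toLin (f : Dual R K) : K →ₗ[R] InjCogenerator R := f

variable {Λ : Type v} [Ring Λ] [Algebra R Λ] [Module Λ K] [IsScalarTower R Λ K]

/-- If `K` is a left `Λ`-module, then `D(K)` is a right `Λ`-module, through
`(f a)(x) = f (a x)`. -/
noncomputable instance : Module Λᵐᵒᵖ (Dual R K) where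
  smul a f := f.toLin ∘ₗ Algebra.lsmul R R K a.unop
  one_smul f := LinearMap.ext fun x => congrArg f.toLin (one_smul Λ x)
  mul_smul a b f := LinearMap.ext fun x => congrArg f.toLin (mul_smul b.unop a.unop x)
  smul_zero _ := LinearMap.zero_comp _
  smul_add _ _ _ := LinearMap.add_comp _ _ _
  add_smul a b f := LinearMap.ext fun x =>
    (congrArg f.toLin (add_smul a.unop b.unop x)).trans (map_add f.toLin _ _)
  zero_smul f := LinearMap.ext fun x =>
    (congrArg f.toLin (zero_smul Λ x)).trans (map_zero f.toLin)

theorem Dual.smul_apply (a : Λᵐᵒᵖ) (f : Dual R K) (x : K) :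
    (a • f).toLin x = f.toLin (a.unop • x) := rfl

instance : IsScalarTower R Λᵐᵒᵖ (Dual R K) where
  smul_assoc r a f := LinearMap.ext fun x => by
    change f.toLin ((r • a.unop) • x) = r • f.toLin (a.unop • x)
    rw [smul_assoc, map_smul]

/-- `D` preserves finite generation over an artinian base ring. -/
theorem Dual.finite_base [IsArtinianRing R] [Module.Finite R K] :
    Module.Finite R (Dual R K) := by
  have key : ∀ (N : Type w) [AddCommGroup N] [Module R N], IsFiniteLength R N →
      IsNoetherian R (N →ₗ[R] InjCogenerator R) := by
    intro N _ _ hN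
    induction hN with
    | of_subsingleton => infer_instance
    | @of_simple_quotient N _ _ N' hs h ih =>
      have hE := injCogeneratorMap_isInjectiveEnvelope R
      have : Module.Finite R (N ⧸ N') := inferInstance
      let c : ((N ⧸ N') →ₗ[R] (R ⧸ Ring.jacobson R)) →ₗ[R]
          ((N ⧸ N') →ₗ[R] InjCogenerator R) := LinearMap.llcomp R _ _ _ (injCogeneratorMap R)
      have hc : Function.Surjective c := by
        intro f
        have hf : LinearMap.range f ≤ LinearMap.range (injCogeneratorMap R) := by
          rcases eq_bot_or_eq_top ((LinearMap.range (injCogeneratorMap R)).comap f) with h0 | h0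
          · have : LinearMap.range f = ⊥ := by
              apply hE.2.2
              rw [eq_bot_iff]
              rintro _ ⟨⟨x, rfl⟩, hx⟩
              have : x ∈ (LinearMap.range (injCogeneratorMap R)).comap f := hx
              rw [h0] at this
              have : x = 0 := this
              rw [this, map_zero]
              exact Submodule.zero_mem _
            rw [this]
            exact bot_le
          · rintro _ ⟨x, rfl⟩
            have : x ∈ (LinearMap.range (injCogeneratorMap R)).comap f := h0 ▸ Submodule.mem_top
            exact this
        let e := LinearEquiv.ofInjective (injCogeneratorMap R) hE.2.1
        refine ⟨e.symm.toLinearMap ∘ₗ f.codRestrict _ fun x => hf ⟨x, rfl⟩, ?_⟩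
        refine LinearMap.ext fun x => ?_
        exact congrArg Subtype.val (e.apply_symm_apply ⟨f x, hf ⟨x, rfl⟩⟩)
      have : IsNoetherian R ((N ⧸ N') →ₗ[R] InjCogenerator R) :=
        isNoetherian_of_surjective c (LinearMap.range_eq_top.2 hc)
      refine isNoetherian_of_range_eq_ker
        (LinearMap.lcomp R (InjCogenerator R) N'.mkQ)
        (LinearMap.lcomp R (InjCogenerator R) N'.subtype) ?_
      ext f
      constructor
      · rintro ⟨g, rfl⟩
        rw [LinearMap.mem_ker]
        refine LinearMap.ext fun x => ?_
        change g (N'.mkQ x) = 0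
        rw [show N'.mkQ (x : N) = 0 by simp, map_zero]
      · intro hf
        refine ⟨N'.liftQ f fun x hx => LinearMap.congr_fun hf ⟨x, hx⟩, ?_⟩
        ext x
        rfl
  have := key K (isFiniteLength_iff_isNoetherian_isArtinian.2 ⟨inferInstance, inferInstance⟩)
  exact inferInstanceAs (Module.Finite R (K →ₗ[R] InjCogenerator R))

/-- For an artin `R`-algebra `Λ`, the dual of a finitely generated module is finitely
generated. -/
theorem Dual.finite [IsArtinianRing R] [Module.Finite R Λ] [Module.Finite Λ K] :
    Module.Finite Λᵐᵒᵖ (Dual R K) :=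
  have : Module.Finite R K := Module.Finite.trans Λ K
  have := Dual.finite_base R K
  Module.Finite.of_restrictScalars_finite R Λᵐᵒᵖ (Dual R K)

end Dual

/-! ### The transpose -/

section Transpose

variable (Λ : Type v) [Ring Λ] (M : Type w) [AddCommGroup M] [Module Λᵐᵒᵖ M]

/-- The first term `P₁` of the minimal projective presentation `P₁ → P₀ → M → 0` of a right
`Λ`-module `M`, where `P₀ = P(M)`: the projective cover of the kernel of `P₀ → M`. -/
abbrev ProjCover₁ : Type v := ProjCover Λᵐᵒᵖ (LinearMap.ker (projCoverMap Λᵐᵒᵖ M))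

/-- The map `P₁ → P₀` of the minimal projective presentation of `M`. -/
noncomputable def minPresentation : ProjCover₁ Λ M →ₗ[Λᵐᵒᵖ] ProjCover Λᵐᵒᵖ M :=
  (LinearMap.ker (projCoverMap Λᵐᵒᵖ M)).subtype ∘ₗ projCoverMap Λᵐᵒᵖ _

/-- The transpose of the right `Λ`-module `M`: the left `Λ`-module which is the cokernel of
`Hom(P₀, Λ) → Hom(P₁, Λ)`. -/
abbrev Tr : Type v :=
  (ProjCover₁ Λ M →ₗ[Λᵐᵒᵖ] Λ) ⧸ LinearMap.range (LinearMap.lcomp Λ Λ (minPresentation Λ M))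

end Transpose

/-! ### Morphisms determined by modules -/

/-- The morphism `α : X → Y` is right determined by `C`: given a finitely generated module `X'`
and any morphism `α' : X' → Y` such that `α' φ` factors through `α` for every `φ : C → X'`,
the morphism `α'` factors through `α`. -/
def IsRightDetermined {Λ : Type v} [Ring Λ] {X : Type w₁} [AddCommGroup X] [Module Λ X]
    {Y : Type w₂} [AddCommGroup Y] [Module Λ Y] (α : X →ₗ[Λ] Y)
    (C : Type w₃) [AddCommGroup C] [Module Λ C] : Prop :=
  ∀ (X' : Type w₄) [AddCommGroup X'] [Module Λ X'] [Module.Finite Λ X'] (α' : X' →ₗ[Λ] Y),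
    (∀ φ : C →ₗ[Λ] X', ∃ ψ : C →ₗ[Λ] X, α' ∘ₗ φ = α ∘ₗ ψ) →
      ∃ β : X' →ₗ[Λ] X, α' = α ∘ₗ β

end ArtinAlg

/-! Let `α' : X' → Y` pass the test on `C`. The two summands of `C` do separate jobs. The summand
`P(soc Q)` forces `im α' ⊆ im α`: otherwise `X' → Q` is nonzero, its image contains a simple `S ⊆
soc Q`, and `P(soc Q) → soc Q → S` lifts to a map into `X'` whose composite with `α'` cannot factor
through `α` (`exists_comp_ne_zero_of_ne_zero`). Then the pullback `Z` of `α` and `α'` is an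
extension of `X'` by `K`, and `α'` factors through `α` once it splits. The summand `Tr D(K)`
supplies the splitting: all maps `Tr D(K) → X'` lift to `Z`, and `exists_retraction_of_lifting`
turns this into a retraction of `K → Z`. That lemma rests on the adjunction-type pairing between
`Hom(P, D(W))` and `Hom(Hom(P, Λ), W)` for finitely generated projective `P`, written with dual
bases. It converts lifting from the transpose into a section of `D(Z) → D(K)`; reflexivity of `K`
(`exists_eq_eval`) dualizes the section back. -/

namespace ArtinAlg

/-! ### Matlis duality over an artinian base ring -/

section Matlis

variable (R : Type u) [CommRing R]

/-- The preimage of `R / rad R` in `S` is zero or everything; if it is zero, essentiality of the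
envelope forces `f = 0`. -/
theorem mem_range_injCogeneratorMap_of_isSimpleModule {S : Type w} [AddCommGroup S] [Module R S]
    [IsSimpleModule R S] (f : S →ₗ[R] InjCogenerator R) (s : S) :
    f s ∈ LinearMap.range (injCogeneratorMap R) := by
  have hE := injCogeneratorMap_isInjectiveEnvelope R
  rcases eq_bot_or_eq_top ((LinearMap.range (injCogeneratorMap R)).comap f) with h0 | h0
  · have hf : LinearMap.range f = ⊥ := by
      apply hE.2.2
      rw [eq_bot_iff]
      rintro _ ⟨⟨x, rfl⟩, hx⟩
      have hx' : x ∈ (LinearMap.range (injCogeneratorMap R)).comap f := hx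
      rw [h0, Submodule.mem_bot] at hx'
      rw [hx', map_zero]
      exact Submodule.zero_mem _
    have hs : f s ∈ LinearMap.range f := ⟨s, rfl⟩
    rw [hf, Submodule.mem_bot] at hs
    rw [hs]
    exact Submodule.zero_mem _
  · exact Submodule.mem_comap.1 (h0 ▸ Submodule.mem_top)

variable [IsArtinianRing R]

/-- Both maps take values in the semisimple ring `R / rad R`, where an annihilator argument with
idempotents applies. This is what makes the dual of a simple module simple or zero. -/
theorem exists_eq_smul_of_isSimpleModule {S : Type w} [AddCommGroup S] [Module R S]
    [IsSimpleModule R S] {f : S →ₗ[R] InjCogenerator R} (hf : f ≠ 0)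
    (g : S →ₗ[R] InjCogenerator R) : ∃ r : R, r • f = g := by
  have hι := (injCogeneratorMap_isInjectiveEnvelope R).2.1
  have := IsSimpleModule.nontrivial R S
  obtain ⟨s, hs⟩ := exists_ne (0 : S)
  have hspan := IsSimpleModule.toSpanSingleton_surjective R hs
  obtain ⟨a, ha⟩ := mem_range_injCogeneratorMap_of_isSimpleModule R f s
  obtain ⟨b, hb⟩ := mem_range_injCogeneratorMap_of_isSimpleModule R g s
  have : IsSemisimpleRing (R ⧸ Ring.jacobson R) := IsSemiprimaryRing.isSemisimpleRing
  obtain ⟨e, hid, he⟩ := IsSemisimpleRing.ideal_eq_span_idempotent (Ideal.span {a})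
  obtain ⟨x, hx⟩ := Ideal.mem_span_singleton'.1 (he ▸ Ideal.mem_span_singleton_self a)
  obtain ⟨c, hc⟩ := Ideal.mem_span_singleton'.1 (he.symm ▸ Ideal.mem_span_singleton_self e)
  have hee : (1 - e) * a = 0 := by
    have he2 : e * e = e := hid
    rw [← hx]; linear_combination (-x) * he2
  -- `1 - e` kills `a`. Since `f` is injective, its lift `t` kills `s`, so `1 - e` also kills `b`.
  -- Thus `b = e b = (b c) a`, and a lift of `b c` is the required scalar.
  obtain ⟨t, ht⟩ := Ideal.Quotient.mk_surjective (1 - e)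
  have hfs : t • f s = 0 := by
    rw [← ha, ← map_smul, Algebra.smul_def]
    change injCogeneratorMap R (Ideal.Quotient.mk _ t * a) = 0
    rw [ht, hee, map_zero]
  have hts : t • s = 0 := by
    apply LinearMap.injective_of_ne_zero hf
    rw [map_smul, hfs, map_zero]
  have hbe : (1 - e) * b = 0 := by
    apply hι
    rw [map_zero, ← ht]
    change injCogeneratorMap R (t • b) = 0
    rw [map_smul, hb, ← map_smul, hts, map_zero]
  obtain ⟨r, hr⟩ := Ideal.Quotient.mk_surjective (b * c)
  refine ⟨r, LinearMap.ext fun y => ?_⟩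
  obtain ⟨z, rfl⟩ := hspan y
  change r • f (z • s) = g (z • s)
  rw [map_smul, map_smul, smul_comm, ← ha, ← hb, ← map_smul (injCogeneratorMap R) r a]
  congr 2
  change Ideal.Quotient.mk _ r * a = b
  rw [hr]
  linear_combination b * hc - hbe

theorem length_dual_le_one {S : Type w} [AddCommGroup S] [Module R S]
    [IsSimpleModule R S] : Module.length R (S →ₗ[R] InjCogenerator R) ≤ 1 := by
  rcases subsingleton_or_nontrivial (S →ₗ[R] InjCogenerator R) with h | h
  · simp
  · have : IsSimpleModule R (S →ₗ[R] InjCogenerator R) :=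
      isSimpleModule_iff_toSpanSingleton_surjective.2
        ⟨h, fun f hf g => exists_eq_smul_of_isSimpleModule R hf g⟩
    rw [Module.length_eq_one]

/-- Induction along a composition series: left exactness of `Hom(-, E)` makes length subadditive,
and each simple factor contributes at most one. -/
theorem length_dual_le {N : Type w} [AddCommGroup N] [Module R N] (hN : IsFiniteLength R N) :
    Module.length R (N →ₗ[R] InjCogenerator R) ≤ Module.length R N := by
  induction hN with
  | of_subsingleton => simp
  | @of_simple_quotient N _ _ N' hs h ih =>
    let a := LinearMap.lcomp R (InjCogenerator R) N'.mkQ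
    let b := LinearMap.lcomp R (InjCogenerator R) N'.subtype
    have ha : Function.Injective a := fun f g hfg =>
      LinearMap.ext fun x => by
        obtain ⟨y, rfl⟩ := N'.mkQ_surjective x
        exact LinearMap.congr_fun hfg y
    have hab : Function.Exact a b.rangeRestrict := by
      intro f
      constructor
      · intro hf
        have hf' : b f = 0 := congrArg Subtype.val hf
        exact ⟨N'.liftQ f fun x hx => LinearMap.congr_fun hf' ⟨x, hx⟩,
          LinearMap.ext fun x => rfl⟩
      · rintro ⟨g, rfl⟩
        refine Subtype.ext (LinearMap.ext fun x => ?_)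
        change g (N'.mkQ x) = 0
        rw [show N'.mkQ (x : N) = 0 by simp, map_zero]
    rw [Module.length_eq_add_of_exact a b.rangeRestrict ha b.surjective_rangeRestrict hab,
      Module.length_eq_add_of_exact N'.subtype N'.mkQ N'.injective_subtype N'.mkQ_surjective
        (LinearMap.exact_subtype_mkQ N'), add_comm]
    refine add_le_add ?_ ?_
    · exact (Module.length_le_of_injective (LinearMap.range b).subtype
        (Submodule.injective_subtype _)).trans ih
    · rw [Module.length_eq_one R (N ⧸ N')]
      exact length_dual_le_one R

/-- `E` is a cogenerator: with `m` a maximal ideal containing the annihilator of `k`, map `R k → R /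
m → R / rad R → E` and extend to `K` by injectivity. The middle arrow `σ` exists because `R / rad R`
is semisimple. -/
theorem exists_dual_apply_ne_zero {K : Type w} [AddCommGroup K] [Module R K] {k : K}
    (hk : k ≠ 0) : ∃ f : K →ₗ[R] InjCogenerator R, f k ≠ 0 := by
  have hE := injCogeneratorMap_isInjectiveEnvelope R
  let τ := LinearMap.toSpanSingleton R K k
  have hτ : LinearMap.ker τ ≠ ⊤ := fun h => hk <| by
    have h1 : (1 : R) ∈ LinearMap.ker τ := h ▸ Submodule.mem_top
    simpa [τ] using h1
  obtain ⟨m, hm, hle⟩ := Ideal.exists_le_maximal (LinearMap.ker τ) hτ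
  have hJ : (Ring.jacobson R : Ideal R) ≤ m := sInf_le hm.out
  have hss : IsSemisimpleModule R (R ⧸ Ring.jacobson R) :=
    (IsArtinian.isSemisimpleModule_iff_jacobson R _).2 (Module.jacobson_quotient_jacobson R R)
  obtain ⟨σ, hσ⟩ := IsSemisimpleModule.lifting_property
    (Submodule.factor hJ) (Submodule.factor_surjective hJ) (LinearMap.id (R := R) (M := R ⧸ m))
  have : Module.Injective R (InjCogenerator R) := hE.1
  let g : LinearMap.range τ →ₗ[R] InjCogenerator R :=
    injCogeneratorMap R ∘ₗ σ ∘ₗ Submodule.factor hle ∘ₗ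
      τ.quotKerEquivRange.symm.toLinearMap
  obtain ⟨f, hf⟩ := Module.Injective.extension_property R _ _ _ (LinearMap.range τ).subtype
    (Submodule.injective_subtype _) g
  refine ⟨f, fun h0 => ?_⟩
  have h1 : g ⟨τ 1, 1, rfl⟩ = 0 := by
    rw [← hf]
    change f (τ 1) = 0
    rwa [LinearMap.toSpanSingleton_apply, one_smul]
  have h2 : τ.quotKerEquivRange.symm ⟨τ 1, 1, rfl⟩ = Submodule.Quotient.mk 1 := by
    rw [LinearEquiv.symm_apply_eq]
    rfl
  have h3 : σ (Submodule.Quotient.mk 1) = 0 := by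
    apply hE.2.1
    rw [map_zero, ← h1]
    change _ = injCogeneratorMap R (σ (Submodule.factor hle (τ.quotKerEquivRange.symm _)))
    rw [h2]
    rfl
  have h4 : (Submodule.Quotient.mk 1 : R ⧸ m) = 0 := by
    rw [← LinearMap.id_apply (R := R) (Submodule.Quotient.mk 1 : R ⧸ m), ← hσ,
      LinearMap.comp_apply, h3, map_zero]
  exact hm.ne_top ((Ideal.eq_top_iff_one m).2 ((Submodule.Quotient.mk_eq_zero m).1 h4))

/-- Evaluation `K → D(D(K))` is surjective: finite length modules are reflexive. -/
theorem exists_eq_eval {K : Type w} [AddCommGroup K] [Module R K] [Module.Finite R K]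
    (θ : (K →ₗ[R] InjCogenerator R) →ₗ[R] InjCogenerator R) : ∃ k : K, ∀ f, θ f = f k := by
  let ev : K →ₗ[R] (K →ₗ[R] InjCogenerator R) →ₗ[R] InjCogenerator R :=
    LinearMap.id.flip
  have hev : Function.Injective ev := by
    rw [← LinearMap.ker_eq_bot, eq_bot_iff]
    intro k hk
    by_contra hk0
    obtain ⟨f, hf⟩ := exists_dual_apply_ne_zero R hk0
    exact hf (LinearMap.congr_fun hk f)
  have hK : IsFiniteLength R K :=
    isFiniteLength_iff_isNoetherian_isArtinian.2 ⟨inferInstance, inferInstance⟩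
  -- Evaluation is injective and the bidual is no longer than `K`, so by finiteness of length its
  -- image cannot be proper.
  have hD : IsFiniteLength R (K →ₗ[R] InjCogenerator R) := Module.length_ne_top_iff.1
    (ne_top_of_le_ne_top (Module.length_ne_top_iff.2 hK) (length_dual_le R hK))
  have hle := (length_dual_le R hD).trans (length_dual_le R hK)
  obtain ⟨_, _⟩ := isFiniteLength_iff_isNoetherian_isArtinian.1 (Module.length_ne_top_iff.1
    (ne_top_of_le_ne_top (Module.length_ne_top_iff.2 hK) hle))
  have hr : LinearMap.range ev = ⊤ := by
    by_contra h
    refine (Submodule.length_lt h).not_ge (hle.trans ?_)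
    exact (LinearEquiv.ofInjective ev hev).length_eq.le
  obtain ⟨k, hk⟩ := (hr ▸ Submodule.mem_top : θ ∈ LinearMap.range ev)
  exact ⟨k, fun f => by rw [← hk]; rfl⟩

end Matlis

/-! ### Dual bases of projective right modules -/

section DualBasis

variable {Λ : Type v} [Ring Λ] {P : Type w} [AddCommGroup P] [Module Λᵐᵒᵖ P]

/-- `p i`, `q i` form a finite dual basis of the right module `P`. -/
def IsDualBasis {n : ℕ} (p : Fin n → P) (q : Fin n → (P →ₗ[Λᵐᵒᵖ] Λ)) : Prop :=
  ∀ x, ∑ i, MulOpposite.op (q i x) • p i = x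

/-- The ring, as a right module over itself, with values in the opposite ring. -/
def unopRight (Λ : Type v) [Ring Λ] : Λᵐᵒᵖ →ₗ[Λᵐᵒᵖ] Λ where
  toFun := MulOpposite.unop
  map_add' _ _ := rfl
  map_smul' _ _ := rfl

theorem exists_isDualBasis [Module.Finite Λᵐᵒᵖ P] [Module.Projective Λᵐᵒᵖ P] :
    ∃ (n : ℕ) (p : Fin n → P) (q : Fin n → (P →ₗ[Λᵐᵒᵖ] Λ)), IsDualBasis p q := by
  obtain ⟨n, f, hf⟩ := Module.Finite.exists_fin' Λᵐᵒᵖ P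
  obtain ⟨g, hg⟩ := Module.projective_lifting_property f LinearMap.id hf
  refine ⟨n, fun i => f (Pi.single i 1),
    fun i => unopRight Λ ∘ₗ LinearMap.proj i ∘ₗ g, fun x => ?_⟩
  have hx : f (g x) = x := LinearMap.congr_fun hg x
  conv_rhs => rw [← hx, ← Finset.univ_sum_single (g x), map_sum]
  refine Finset.sum_congr rfl fun i _ => ?_
  change g x i • f (Pi.single i 1) = _
  rw [← map_smul, ← Pi.single_smul, smul_eq_mul, mul_one]

variable {n : ℕ} {p : Fin n → P} {q : Fin n → (P →ₗ[Λᵐᵒᵖ] Λ)}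

theorem IsDualBasis.sum_smul (h : IsDualBasis p q) (f : P →ₗ[Λᵐᵒᵖ] Λ) :
    ∑ i, f (p i) • q i = f := by
  ext x
  conv_rhs => rw [← h x, map_sum]
  rw [LinearMap.sum_apply]
  exact Finset.sum_congr rfl fun i _ => (map_smul f _ _).symm

theorem IsDualBasis.finite_dual (h : IsDualBasis p q) : Module.Finite Λ (P →ₗ[Λᵐᵒᵖ] Λ) := by
  refine Module.Finite.of_surjective (Fintype.linearCombination Λ q) fun f => ?_
  exact ⟨fun i => f (p i), h.sum_smul f⟩

end DualBasis

/-! ### The pairing between `Hom(P, D(W))` and `Hom(Hom(P, Λ), W)` -/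

section Pairing

variable (R : Type u) [CommRing R] {Λ : Type v} [Ring Λ] [Algebra R Λ]
variable {P : Type w} [AddCommGroup P] [Module Λᵐᵒᵖ P]
variable {W : Type w₁} [AddCommGroup W] [Module R W] [Module Λ W] [IsScalarTower R Λ W]
variable {n : ℕ} {p : Fin n → P} {q : Fin n → (P →ₗ[Λᵐᵒᵖ] Λ)}

/-- The evaluation pairing attached to a dual basis `p`, `q` of `P`. -/
noncomputable def dualPairing (p : Fin n → P) (q : Fin n → (P →ₗ[Λᵐᵒᵖ] Λ))
    (h : P →ₗ[Λᵐᵒᵖ] Dual R W) :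
    ((P →ₗ[Λᵐᵒᵖ] Λ) →ₗ[Λ] W) →ₗ[R] InjCogenerator R :=
  ∑ i, (h (p i)).toLin ∘ₗ
    { toFun := fun ξ => ξ (q i)
      map_add' := fun _ _ => rfl
      map_smul' := fun _ _ => rfl }

theorem dualPairing_apply (h : P →ₗ[Λᵐᵒᵖ] Dual R W) (ξ : (P →ₗ[Λᵐᵒᵖ] Λ) →ₗ[Λ] W) :
    dualPairing R p q h ξ = ∑ i, (h (p i)).toLin (ξ (q i)) := by
  rw [dualPairing, LinearMap.sum_apply]
  rfl

theorem Dual.toLin_sum {ι : Type*} (s : Finset ι) (f : ι → Dual R W) (x : W) :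
    (∑ i ∈ s, f i).toLin x = ∑ i ∈ s, (f i).toLin x :=
  map_sum (LinearMap.applyₗ (R := R) x : (W →ₗ[R] InjCogenerator R) →ₗ[R] InjCogenerator R) f s

/-- The element `x` of `P` and `w` in `W` define the map `f ↦ f(x) w`. -/
def evalSMul (x : P) (w : W) : (P →ₗ[Λᵐᵒᵖ] Λ) →ₗ[Λ] W where
  toFun f := f x • w
  map_add' _ _ := add_smul _ _ _
  map_smul' _ _ := mul_smul _ _ _

theorem IsDualBasis.dualPairing_evalSMul (hpq : IsDualBasis p q) (h : P →ₗ[Λᵐᵒᵖ] Dual R W)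
    (x : P) (w : W) : dualPairing R p q h (evalSMul x w) = (h x).toLin w := by
  conv_rhs => rw [← hpq x, map_sum, Dual.toLin_sum]
  rw [dualPairing_apply]
  refine Finset.sum_congr rfl fun i _ => ?_
  rw [map_smul, Dual.smul_apply]
  rfl

/-- Naturality of the pairing in `P`: expand `d (p i)` in the dual basis of `P'`, swap the sums, and
recombine `q' j ∘ d` from the `q i`. -/
theorem IsDualBasis.dualPairing_comp {P' : Type w₂} [AddCommGroup P'] [Module Λᵐᵒᵖ P']
    {m : ℕ} {p' : Fin m → P'} {q' : Fin m → (P' →ₗ[Λᵐᵒᵖ] Λ)} (hpq : IsDualBasis p q)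
    (hpq' : IsDualBasis p' q') (d : P →ₗ[Λᵐᵒᵖ] P') (g : P' →ₗ[Λᵐᵒᵖ] Dual R W)
    (ξ : (P →ₗ[Λᵐᵒᵖ] Λ) →ₗ[Λ] W) :
    dualPairing R p q (g ∘ₗ d) ξ = dualPairing R p' q' g (ξ ∘ₗ LinearMap.lcomp Λ Λ d) := by
  have h1 : ∀ i, (g (d (p i))).toLin (ξ (q i)) =
      ∑ j, (g (p' j)).toLin (ξ (q' j (d (p i)) • q i)) := by
    intro i
    conv_lhs => rw [← hpq' (d (p i)), map_sum, Dual.toLin_sum]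
    refine Finset.sum_congr rfl fun j _ => ?_
    rw [map_smul g, Dual.smul_apply, map_smul ξ]
    rfl
  rw [dualPairing_apply, dualPairing_apply]
  simp_rw [LinearMap.comp_apply, h1]
  rw [Finset.sum_comm]
  refine Finset.sum_congr rfl fun j _ => ?_
  rw [← map_sum, ← map_sum]
  congr 2
  exact hpq.sum_smul (q' j ∘ₗ d)

/-- The functional paired with `h` vanishes on the kernel of `T`, so it descends to the range of `T`
and extends to a functional `θ` by injectivity of `E`. Reading `θ` on the maps `evalSMul x w` gives
`k`. -/
theorem exists_eq_comp_of_dualPairing_eq_zero {P' : Type w₂} [AddCommGroup P'] [Module Λᵐᵒᵖ P']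
    (hpq : IsDualBasis p q) (d : P →ₗ[Λᵐᵒᵖ] P') (h : P →ₗ[Λᵐᵒᵖ] Dual R W)
    (hh : ∀ ξ : (P →ₗ[Λᵐᵒᵖ] Λ) →ₗ[Λ] W, ξ ∘ₗ LinearMap.lcomp Λ Λ d = 0 →
      dualPairing R p q h ξ = 0) :
    ∃ k : P' →ₗ[Λᵐᵒᵖ] Dual R W, h = k ∘ₗ d := by
  have hE : Module.Injective R (InjCogenerator R) := (injCogeneratorMap_isInjectiveEnvelope R).1
  let T : ((P →ₗ[Λᵐᵒᵖ] Λ) →ₗ[Λ] W) →ₗ[R] ((P' →ₗ[Λᵐᵒᵖ] Λ) →ₗ[Λ] W) :=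
    { toFun := fun ξ => ξ ∘ₗ LinearMap.lcomp Λ Λ d
      map_add' := fun _ _ => rfl
      map_smul' := fun _ _ => rfl }
  have hker : LinearMap.ker T ≤ LinearMap.ker (dualPairing R p q h) := fun ξ hξ => hh ξ hξ
  let φ : LinearMap.range T →ₗ[R] InjCogenerator R :=
    (LinearMap.ker T).liftQ (dualPairing R p q h) hker ∘ₗ T.quotKerEquivRange.symm.toLinearMap
  obtain ⟨θ, hθ⟩ := Module.Injective.extension_property R _ _ _ (LinearMap.range T).subtype
    (Submodule.injective_subtype _) φ
  have hθT : ∀ ξ, θ (T ξ) = dualPairing R p q h ξ := by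
    intro ξ
    have h1 : φ ⟨T ξ, ξ, rfl⟩ = θ (T ξ) := by rw [← hθ]; rfl
    have h2 : T.quotKerEquivRange.symm ⟨T ξ, ξ, rfl⟩ = Submodule.Quotient.mk ξ := by
      rw [LinearEquiv.symm_apply_eq]
      rfl
    rw [← h1]
    change (LinearMap.ker T).liftQ _ hker (T.quotKerEquivRange.symm _) = _
    rw [h2]
    rfl
  let k : P' →ₗ[Λᵐᵒᵖ] Dual R W :=
    { toFun := fun x =>
        (θ ∘ₗ
          { toFun := fun w => evalSMul x w
            map_add' := fun a b => LinearMap.ext fun f => smul_add _ _ _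
            map_smul' := fun r a => LinearMap.ext fun f => smul_comm _ _ _ } :
          W →ₗ[R] InjCogenerator R)
      map_add' := fun x y => LinearMap.ext fun w => by
        change θ (evalSMul (x + y) w) = θ (evalSMul x w) + θ (evalSMul y w)
        rw [← map_add]
        congr 1
        ext f
        change f (x + y) • w = f x • w + f y • w
        rw [map_add, add_smul]
      map_smul' := fun a x => LinearMap.ext fun w => by
        change θ (evalSMul (a • x) w) = θ (evalSMul x (a.unop • w))
        congr 1
        ext f
        change f (a • x) • w = f x • a.unop • w
        rw [map_smul, smul_smul]
        rfl }
  refine ⟨k, LinearMap.ext fun x => LinearMap.ext fun w => ?_⟩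
  change (h x).toLin w = θ (evalSMul (d x) w)
  rw [← hpq.dualPairing_evalSMul R h x w, ← hθT]
  rfl

end Pairing

/-! ### Splitting of extensions along which maps from the transpose lift -/

section Splitting

variable (R : Type u) [CommRing R] {Λ : Type v} [Ring Λ] [Algebra R Λ]
variable {K : Type w} [AddCommGroup K] [Module R K] [Module Λ K] [IsScalarTower R Λ K]
variable {Z : Type w₁} [AddCommGroup Z] [Module R Z] [Module Λ Z] [IsScalarTower R Λ Z]
variable {W : Type w₂} [AddCommGroup W] [Module R W] [Module Λ W] [IsScalarTower R Λ W]

/-- The duality `D` on morphisms. -/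
noncomputable def Dual.map (f : Z →ₗ[Λ] W) : Dual R W →ₗ[Λᵐᵒᵖ] Dual R Z where
  toFun g := g.toLin ∘ₗ f.restrictScalars R
  map_add' _ _ := rfl
  map_smul' a g := LinearMap.ext fun z => congrArg g.toLin (map_smul f a.unop z).symm

theorem Dual.map_apply (f : Z →ₗ[Λ] W) (g : Dual R W) (z : Z) :
    (Dual.map R f g).toLin z = g.toLin (f z) := rfl

theorem Dual.map_surjective {f : Z →ₗ[Λ] W} (hf : Function.Injective f) :
    Function.Surjective (Dual.map R f) := by
  have hE : Module.Injective R (InjCogenerator R) := (injCogeneratorMap_isInjectiveEnvelope R).1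
  exact fun g => Module.Injective.extension_property R _ _ _ (f.restrictScalars R) hf g.toLin

theorem Dual.exists_map_eq {i : K →ₗ[Λ] Z} {π : Z →ₗ[Λ] W} (hπ : Function.Surjective π)
    (hex : LinearMap.ker π ≤ LinearMap.range i) {g : Dual R Z} (hg : Dual.map R i g = 0) :
    ∃ h : Dual R W, Dual.map R π h = g := by
  have hker : LinearMap.ker (π.restrictScalars R) ≤ LinearMap.ker g.toLin := by
    intro z hz
    obtain ⟨k, rfl⟩ := hex hz
    exact LinearMap.congr_fun hg k
  have hπ' : Function.Surjective (π.restrictScalars R) := hπ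
  refine ⟨((LinearMap.ker (π.restrictScalars R)).liftQ g.toLin hker ∘ₗ
    ((π.restrictScalars R).quotKerEquivOfSurjective hπ').symm.toLinearMap :
      W →ₗ[R] InjCogenerator R), LinearMap.ext fun z => ?_⟩
  have h2 : ((π.restrictScalars R).quotKerEquivOfSurjective hπ').symm (π z) =
      Submodule.Quotient.mk z := by
    rw [LinearEquiv.symm_apply_eq]
    rfl
  change (LinearMap.ker (π.restrictScalars R)).liftQ g.toLin hker
    (((π.restrictScalars R).quotKerEquivOfSurjective hπ').symm (π z)) = g.toLin z
  rw [h2]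
  rfl

/-- A right linear section of `D(Z) → D(K)` yields a retraction of `K → Z`. -/
theorem exists_retraction_of_dual_section [IsArtinianRing R] [Module.Finite R K]
    (i : K →ₗ[Λ] Z) (s : Dual R K →ₗ[Λᵐᵒᵖ] Dual R Z)
    (hs : ∀ f, Dual.map R i (s f) = f) : ∃ r : Z →ₗ[Λ] K, r ∘ₗ i = LinearMap.id := by
  -- `f ↦ (s f)(z)` lies in the bidual of `K`, hence is evaluation at a point, taken as `r z`.
  -- Functionals separate points (`hsep`), which makes `r` linear over `Λ`.
  have hex : ∀ z : Z, ∃ k : K, ∀ f : Dual R K, (s f).toLin z = f.toLin k := fun z =>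
    exists_eq_eval R ((LinearMap.applyₗ (R := R) z :
      (Z →ₗ[R] InjCogenerator R) →ₗ[R] InjCogenerator R) ∘ₗ s.restrictScalars R)
  choose r hr using hex
  have hsep : ∀ k l : K, (∀ f : Dual R K, f.toLin k = f.toLin l) → k = l := by
    intro k l h
    by_contra hkl
    obtain ⟨f, hf⟩ := exists_dual_apply_ne_zero R (sub_ne_zero.2 hkl)
    exact hf (by rw [map_sub, sub_eq_zero]; exact h f)
  refine ⟨⟨⟨r, fun x y => hsep _ _ fun f => ?_⟩, fun a x => hsep _ _ fun f => ?_⟩,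
    LinearMap.ext fun k => hsep _ _ fun f => ?_⟩
  · rw [map_add, ← hr, ← hr, ← hr, map_add]
  · have h1 := hr x (MulOpposite.op a • f)
    rw [map_smul, Dual.smul_apply, Dual.smul_apply] at h1
    rw [← hr]
    exact h1
  · change f.toLin (r (i k)) = f.toLin k
    rw [← hr, ← Dual.map_apply, hs]

/-- Maps `ξ` killing the image of `Hom(d, Λ)` are maps out of its cokernel, the transpose when `d`
is the minimal presentation; `hlift` says that these lift along `π`. Lift `e` to `g : P₀ → D(Z)`. On
`P₁`, `g ∘ d` comes from some `h : P₁ → D(W)`. If `h = u ∘ d`, then `g - D(π) ∘ u` kills `ker e` and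
descends to a section of `D(i)`. -/
theorem exists_retraction_of_lifting [IsArtinianRing R] [Module.Finite R K]
    {P₀ : Type*} [AddCommGroup P₀] [Module Λᵐᵒᵖ P₀] [Module.Finite Λᵐᵒᵖ P₀]
    [Module.Projective Λᵐᵒᵖ P₀]
    {P₁ : Type*} [AddCommGroup P₁] [Module Λᵐᵒᵖ P₁] [Module.Finite Λᵐᵒᵖ P₁]
    [Module.Projective Λᵐᵒᵖ P₁] (d : P₁ →ₗ[Λᵐᵒᵖ] P₀) (e : P₀ →ₗ[Λᵐᵒᵖ] Dual R K)
    (he : Function.Surjective e) (hde : LinearMap.range d = LinearMap.ker e)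
    {i : K →ₗ[Λ] Z} {π : Z →ₗ[Λ] W} (hi : Function.Injective i) (hπ : Function.Surjective π)
    (hiπ : LinearMap.range i = LinearMap.ker π)
    (hlift : ∀ ξ : (P₁ →ₗ[Λᵐᵒᵖ] Λ) →ₗ[Λ] W, ξ ∘ₗ LinearMap.lcomp Λ Λ d = 0 →
      ∃ ζ : (P₁ →ₗ[Λᵐᵒᵖ] Λ) →ₗ[Λ] Z, ζ ∘ₗ LinearMap.lcomp Λ Λ d = 0 ∧ π ∘ₗ ζ = ξ) :
    ∃ r : Z →ₗ[Λ] K, r ∘ₗ i = LinearMap.id := by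
  obtain ⟨n, p, q, hpq⟩ := exists_isDualBasis (Λ := Λ) (P := P₁)
  obtain ⟨m, p', q', hpq'⟩ := exists_isDualBasis (Λ := Λ) (P := P₀)
  obtain ⟨g, hg⟩ := Module.projective_lifting_property (Dual.map R i) e (Dual.map_surjective R hi)
  have hπi : ∀ f : Dual R W, Dual.map R i (Dual.map R π f) = 0 := by
    refine fun f => LinearMap.ext fun k => ?_
    have : π (i k) = 0 := (hiπ ▸ ⟨k, rfl⟩ : i k ∈ LinearMap.ker π)
    change f.toLin (π (i k)) = 0
    rw [this, map_zero]
  have hed : ∀ x, e (d x) = 0 := fun x => (hde ▸ ⟨x, rfl⟩ : d x ∈ LinearMap.ker e)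
  let π' : Dual R W →ₗ[Λᵐᵒᵖ] LinearMap.ker (Dual.map R i) :=
    (Dual.map R π).codRestrict _ hπi
  have hπ' : Function.Surjective π' := by
    rintro ⟨f, hf⟩
    obtain ⟨h, hh⟩ := Dual.exists_map_eq R hπ hiπ.ge hf
    exact ⟨h, Subtype.ext hh⟩
  obtain ⟨h, hh⟩ := Module.projective_lifting_property π'
    ((g ∘ₗ d).codRestrict (LinearMap.ker (Dual.map R i)) fun x =>
      (LinearMap.congr_fun hg (d x)).trans (hed x)) hπ'
  have hh' : ∀ x, Dual.map R π (h x) = g (d x) := fun x =>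
    congrArg Subtype.val (LinearMap.congr_fun hh x)
  -- Writing `ξ = π ∘ ζ`, move `π` onto `h` to get `g ∘ d` paired with `ζ`, then move `d` across:
  -- the result pairs `g` with `ζ ∘ Hom(d, Λ) = 0`.
  obtain ⟨u, hu⟩ := exists_eq_comp_of_dualPairing_eq_zero R hpq d h fun ξ hξ => by
    obtain ⟨ζ, hζ, rfl⟩ := hlift ξ hξ
    have h1 : dualPairing R p q h (π ∘ₗ ζ) = dualPairing R p q (g ∘ₗ d) ζ := by
      rw [dualPairing_apply, dualPairing_apply]
      refine Finset.sum_congr rfl fun j _ => ?_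
      rw [LinearMap.comp_apply, LinearMap.comp_apply, ← hh', Dual.map_apply]
    rw [h1, hpq.dualPairing_comp R hpq', hζ, map_zero]
  let t : P₀ →ₗ[Λᵐᵒᵖ] Dual R Z := g - Dual.map R π ∘ₗ u
  have ht : LinearMap.ker e ≤ LinearMap.ker t := by
    rw [← hde]
    rintro _ ⟨x, rfl⟩
    change g (d x) - Dual.map R π (u (d x)) = 0
    rw [← hh', hu, LinearMap.comp_apply, sub_self]
  refine exists_retraction_of_dual_section R i
    ((LinearMap.ker e).liftQ t ht ∘ₗ (e.quotKerEquivOfSurjective he).symm.toLinearMap) fun f => ?_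
  obtain ⟨x, rfl⟩ := he f
  have h2 : (e.quotKerEquivOfSurjective he).symm (e x) = Submodule.Quotient.mk x := by
    rw [LinearEquiv.symm_apply_eq]
    rfl
  change Dual.map R i ((LinearMap.ker e).liftQ t ht
    ((e.quotKerEquivOfSurjective he).symm (e x))) = e x
  rw [h2]
  change Dual.map R i (g x - Dual.map R π (u x)) = e x
  rw [map_sub, hπi, sub_zero]
  exact LinearMap.congr_fun hg x

end Splitting

/-! ### Right determined morphisms -/

section Determined

variable {Λ : Type v} [Ring Λ]

theorem isSemisimpleModule_socle (M : Type w) [AddCommGroup M] [Module Λ M] :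
    IsSemisimpleModule Λ (socle Λ M) := by
  rw [socle, sSup_eq_iSup]
  exact isSemisimpleModule_biSup_of_isSemisimpleModule_submodule fun S hS =>
    have : IsSimpleModule Λ S := hS
    inferInstance

/-- If a map to `Q` from a module `X'` is nonzero, then so is its composition with some map
`P(soc Q) → X'`. -/
theorem exists_comp_ne_zero_of_ne_zero [IsArtinianRing Λ] {X' : Type w₁} [AddCommGroup X']
    [Module Λ X'] {Q : Type w} [AddCommGroup Q] [Module Λ Q] [Module.Finite Λ Q]
    {f : X' →ₗ[Λ] Q} (hf : f ≠ 0) :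
    ∃ φ : ProjCover Λ (socle Λ Q) →ₗ[Λ] X', f ∘ₗ φ ≠ 0 := by
  obtain ⟨hproj, hsurj, -⟩ := projCoverMap_isProjectiveCover Λ (socle Λ Q)
  have hsemi := isSemisimpleModule_socle (Λ := Λ) Q
  obtain ⟨S, hS, hSf⟩ := (eq_bot_or_exists_atom_le (LinearMap.range f)).resolve_left
    (by rwa [LinearMap.range_eq_bot])
  have hSs : S ≤ socle Λ Q := le_sSup (isSimpleModule_iff_isAtom.2 hS)
  -- `τ` projects the semisimple socle onto `S`. The lift is taken along `f⁻¹(S) → S`, which is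
  -- surjective although `f` need not be.
  obtain ⟨τ, hτ⟩ := IsSemisimpleModule.extension_property (Submodule.inclusion hSs)
    (Submodule.inclusion_injective hSs) (LinearMap.id (R := Λ) (M := S))
  let F : S.comap f →ₗ[Λ] S := f.restrict fun _ h => h
  have hF : Function.Surjective F := by
    rintro ⟨y, hy⟩
    obtain ⟨x, rfl⟩ := hSf hy
    exact ⟨⟨x, hy⟩, rfl⟩
  obtain ⟨φ, hφ⟩ := Module.projective_lifting_property F (τ ∘ₗ projCoverMap Λ (socle Λ Q)) hF
  refine ⟨(S.comap f).subtype ∘ₗ φ, fun h0 => hS.1 ?_⟩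
  rw [eq_bot_iff]
  intro y hy
  obtain ⟨x, hx⟩ := hsurj ⟨y, hSs hy⟩
  have h1 : F (φ x) = ⟨y, hy⟩ := by
    rw [← LinearMap.comp_apply, hφ, LinearMap.comp_apply, hx]
    exact LinearMap.congr_fun hτ ⟨y, hy⟩
  have h2 : f (φ x) = y := congrArg Subtype.val h1
  rw [Submodule.mem_bot, ← h2]
  exact LinearMap.congr_fun h0 x

theorem isArtinianRing_of_finite (R : Type u) [CommRing R] [IsArtinianRing R] [Algebra R Λ]
    [Module.Finite R Λ] : IsArtinianRing Λ :=
  have : IsArtinian R Λ := inferInstance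
  isArtinian_of_tower R this

theorem isArtinianRing_mulOpposite (R : Type u) [CommRing R] [IsArtinianRing R] [Algebra R Λ]
    [Module.Finite R Λ] : IsArtinianRing Λᵐᵒᵖ :=
  isArtinianRing_of_finite (Λ := Λᵐᵒᵖ) R

theorem finite_tr (R : Type u) [CommRing R] [IsArtinianRing R] [Algebra R Λ]
    [Module.Finite R Λ]
    {M : Type w} [AddCommGroup M] [Module Λᵐᵒᵖ M] [Module.Finite Λᵐᵒᵖ M] :
    Module.Finite Λ (Tr Λ M) := by
  have := isArtinianRing_mulOpposite (Λ := Λ) R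
  have hP := (projCoverMap_isProjectiveCover Λᵐᵒᵖ (LinearMap.ker (projCoverMap Λᵐᵒᵖ M))).1
  obtain ⟨n, p, q, hpq⟩ := exists_isDualBasis (Λ := Λ) (P := ProjCover₁ Λ M)
  have := hpq.finite_dual
  infer_instance

/-- A morphism `α'` into the codomain of `α` whose range is contained in the range of `α` factors
through `α` as soon as its compositions with all maps from `Tr D(Ker α)` do. -/
theorem exists_factorization_of_range_le (R : Type u) [CommRing R] [IsArtinianRing R] [Algebra R Λ]
    [Module.Finite R Λ]
    {X : Type w₁} [AddCommGroup X] [Module R X] [Module Λ X] [IsScalarTower R Λ X]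
    [Module.Finite Λ X] {Y : Type w₂} [AddCommGroup Y] [Module Λ Y]
    {X' : Type w₃} [AddCommGroup X'] [Module Λ X'] (α : X →ₗ[Λ] Y) (α' : X' →ₗ[Λ] Y)
    (hrange : LinearMap.range α' ≤ LinearMap.range α)
    (hα' : ∀ φ : Tr Λ (Dual R (LinearMap.ker α)) →ₗ[Λ] X',
      ∃ ψ : Tr Λ (Dual R (LinearMap.ker α)) →ₗ[Λ] X, α' ∘ₗ φ = α ∘ₗ ψ) :
    ∃ β : X' →ₗ[Λ] X, α' = α ∘ₗ β := by
  have := isArtinianRing_of_finite (Λ := Λ) R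
  have := isArtinianRing_mulOpposite (Λ := Λ) R
  -- The test module carries only a `Λ`-structure; its dual needs the restricted `R`-structure.
  let _ : Module R X' := Module.compHom X' (algebraMap R Λ)
  have : IsScalarTower R Λ X' := IsScalarTower.of_algebraMap_smul fun _ _ => rfl
  have : Module.Finite R (LinearMap.ker α) := Module.Finite.trans Λ _
  have := Dual.finite R (LinearMap.ker α) (Λ := Λ)
  obtain ⟨hP₀, he, -⟩ := projCoverMap_isProjectiveCover Λᵐᵒᵖ (Dual R (LinearMap.ker α))
  obtain ⟨hP₁, he₁, -⟩ := projCoverMap_isProjectiveCover Λᵐᵒᵖ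
    (LinearMap.ker (projCoverMap Λᵐᵒᵖ (Dual R (LinearMap.ker α))))
  let Z : Submodule Λ (X × X') :=
    LinearMap.ker (α ∘ₗ LinearMap.fst Λ X X' - α' ∘ₗ LinearMap.snd Λ X X')
  have hZ : ∀ z : X × X', z ∈ Z ↔ α z.1 = α' z.2 := fun z => sub_eq_zero
  let i : LinearMap.ker α →ₗ[Λ] Z :=
    (LinearMap.inl Λ X X' ∘ₗ (LinearMap.ker α).subtype).codRestrict Z fun k =>
      (hZ _).2 (k.2.trans (map_zero α').symm)
  let π : Z →ₗ[Λ] X' := LinearMap.snd Λ X X' ∘ₗ Z.subtype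
  have hi : Function.Injective i := fun k l h => Subtype.ext congr(($h).1.1)
  have hπ : Function.Surjective π := fun x' => by
    obtain ⟨x, hx⟩ := hrange ⟨x', rfl⟩
    exact ⟨⟨(x, x'), (hZ _).2 hx⟩, rfl⟩
  have hiπ : LinearMap.range i = LinearMap.ker π := by
    ext z
    constructor
    · rintro ⟨k, rfl⟩
      rfl
    · intro hz
      have hz2 : z.1.2 = 0 := hz
      refine ⟨⟨z.1.1, ?_⟩, Subtype.ext (Prod.ext rfl hz2.symm)⟩
      rw [LinearMap.mem_ker, (hZ _).1 z.2, hz2, map_zero]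
  obtain ⟨r, hr⟩ := exists_retraction_of_lifting R (minPresentation Λ (Dual R (LinearMap.ker α)))
    (projCoverMap Λᵐᵒᵖ (Dual R (LinearMap.ker α))) he
    (by rw [minPresentation, LinearMap.range_comp, LinearMap.range_eq_top.2 he₁,
      Submodule.map_top, Submodule.range_subtype]) hi hπ hiπ fun ξ hξ => by
    have hle : LinearMap.range (LinearMap.lcomp Λ Λ
        (minPresentation Λ (Dual R (LinearMap.ker α)))) ≤ LinearMap.ker ξ :=
      LinearMap.range_le_ker_iff.2 hξ
    -- The factorization `α' ξ = α ψ` says exactly that `(ψ, ξ)` lands in the pullback `Z`.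
    obtain ⟨ψ, hψ⟩ := hα' (Submodule.liftQ _ ξ hle)
    refine ⟨((ψ ∘ₗ Submodule.mkQ _).prod ξ).codRestrict Z fun f =>
      (hZ _).2 (LinearMap.congr_fun hψ (Submodule.Quotient.mk f)).symm, ?_,
      LinearMap.ext fun f => rfl⟩
    refine LinearMap.ext fun f => Subtype.ext (Prod.ext ?_ (LinearMap.congr_fun hξ f))
    change ψ (Submodule.Quotient.mk _) = 0
    rw [(Submodule.Quotient.mk_eq_zero
      (LinearMap.range (LinearMap.lcomp Λ Λ (minPresentation Λ (Dual R (LinearMap.ker α)))))).2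
      ⟨f, rfl⟩, map_zero]
  -- Subtracting `r` makes the first projection vanish on `K`, so it descends to `X'`; composition
  -- with `α` is unchanged because `r` takes values in `ker α`.
  let t : Z →ₗ[Λ] X := LinearMap.fst Λ X X' ∘ₗ Z.subtype - (LinearMap.ker α).subtype ∘ₗ r
  have ht : LinearMap.ker π ≤ LinearMap.ker t := by
    rw [← hiπ]
    rintro _ ⟨k, rfl⟩
    change (k : X) - r (i k) = 0
    rw [← LinearMap.comp_apply, hr, LinearMap.id_apply, sub_self]
  refine ⟨(LinearMap.ker π).liftQ t ht ∘ₗ (π.quotKerEquivOfSurjective hπ).symm.toLinearMap,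
    LinearMap.ext fun x' => ?_⟩
  obtain ⟨z, rfl⟩ := hπ x'
  have h2 : (π.quotKerEquivOfSurjective hπ).symm (π z) = Submodule.Quotient.mk z := by
    rw [LinearEquiv.symm_apply_eq]
    rfl
  change α' z.1.2 = α ((LinearMap.ker π).liftQ t ht ((π.quotKerEquivOfSurjective hπ).symm (π z)))
  rw [h2]
  change α' z.1.2 = α (z.1.1 - r z)
  rw [map_sub, (r z).2, sub_zero]
  exact ((hZ _).1 z.2).symm

end Determined

end ArtinAlg

theorem theorem1 {R : Type u} [CommRing R] [IsArtinianRing R]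
    {Λ : Type v} [Ring Λ] [Algebra R Λ] [Module.Finite R Λ]
    {X : Type w₁} [AddCommGroup X] [Module R X] [Module Λ X] [IsScalarTower R Λ X]
    [Module.Finite Λ X]
    {Y : Type w₂} [AddCommGroup Y] [Module Λ Y] [Module.Finite Λ Y]
    (α : X →ₗ[Λ] Y) :
    Module.Finite Λ
        (ArtinAlg.Tr Λ (ArtinAlg.Dual R (LinearMap.ker α)) ×
          ArtinAlg.ProjCover Λ (ArtinAlg.socle Λ (Y ⧸ LinearMap.range α))) ∧
      ArtinAlg.IsRightDetermined.{v, w₁, w₂, v, w₃} α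
        (ArtinAlg.Tr Λ (ArtinAlg.Dual R (LinearMap.ker α)) ×
          ArtinAlg.ProjCover Λ (ArtinAlg.socle Λ (Y ⧸ LinearMap.range α))) := by
  have := ArtinAlg.isArtinianRing_of_finite (Λ := Λ) R
  have := ArtinAlg.Dual.finite R (LinearMap.ker α) (Λ := Λ)
  have := ArtinAlg.finite_tr (Λ := Λ) R (M := ArtinAlg.Dual R (LinearMap.ker α))
  refine ⟨inferInstance, fun X' _ _ _ α' hα' => ?_⟩
  refine ArtinAlg.exists_factorization_of_range_le R α α' ?_ fun φ => ?_
  · rw [← (LinearMap.range α).ker_mkQ, LinearMap.range_le_ker_iff]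
    by_contra hne
    obtain ⟨φ, hφ⟩ := ArtinAlg.exists_comp_ne_zero_of_ne_zero hne
    obtain ⟨ψ, hψ⟩ := hα' (φ ∘ₗ LinearMap.snd Λ _ _)
    refine hφ (LinearMap.ext fun x => ?_)
    have h1 : α' (φ x) = α (ψ (0, x)) := LinearMap.congr_fun hψ (0, x)
    change (LinearMap.range α).mkQ (α' (φ x)) = 0
    rw [h1]
    exact (Submodule.Quotient.mk_eq_zero _).2 ⟨_, rfl⟩
  · obtain ⟨ψ, hψ⟩ := hα' (φ ∘ₗ LinearMap.fst Λ _ _)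
    refine ⟨ψ ∘ₗ LinearMap.inl Λ _ _, LinearMap.ext fun x => ?_⟩
    exact LinearMap.congr_fun hψ (x, 0)
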